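/- Let $\mathbb N=\{1,2,3,\dots\}$. A \emph{density measure} is a finitely additive function $\mu:\mathcal P(\mathbb N)\to[0,1]$ (that is, $\mu(A\cup B)=\mu(A)+\mu(B)$ for disjoint $A,B$) such that $\mu(A)=d(A)$ for every $A\subseteq\mathbb N$ having an asymptotic density $d(A)=\lim_{n\to\infty}\frac{|A\cap\{1,\dots,n\}|}{n}$. For $\theta\in(0,1)$, $n\in\mathbb N$ and a bounded real sequence $x=(x_i)_{i\in\mathbb N}$ put $$\Theta_{\theta,n}(x)=\frac{1}{n(1-\theta)}\sum_{\theta n<i\le n}x_i .$$ For an ultrafilter $\mathcal U$ on $\mathbb N$ and a bounded real sequence $(y_n)$, the limit $\mathcal U\text{-}\lim_n y_n$ is the unique real $L$ such that $\{n:|y_n-L|<\varepsilon\}\in\mathcal U$ for every $\varepsilon>0$. Let $(\theta_k)_{k\in\mathbb N}$ be any sequence in $(0,1)$ with $\theta_k\to1$ and let $\mathcal F$ be any free ultrafilter on $\mathbb N$. For each free ultrafilter $\mathcal G$ on $\mathbb N$ define, for $A\subseteq\mathbb N$ with characteristic sequence $\chi_A$, $$\mu_{\mathcal G}(A)=\mathcal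 F\text{-}\lim_k\ \mathcal G\text{-}\lim_n\ \Theta_{\theta_k,n}(\chi_A),$$ and let $S=\{\mu_{\mathcal G}:\mathcal G\text{ a free ultrafilter on }\mathbb N\}$. Then, in the topology of setwise convergence on real-valued functions on $\mathcal P(\mathbb N)$, the closed convex hull of $S$ is exactly the set of all density measures; equivalently, $S$ consists of density measures and its closure $\overline S$ contains all extreme points of the set of density measures. -/

import Mathlib

open Filter Topology

noncomputable section

namespace DensityMeasures

/-- The counting function `A(n) = |A ∩ {1, …, n}|` of a set `A` of positive integers. -/
def count (A : Set ℕ+) (n : ℕ+) : ℕ := (A ∩ Set.Icc 1 n).ncard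

/-- The set `A` of positive integers has asymptotic density `d`. -/
def HasDensity (A : Set ℕ+) (d : ℝ) : Prop :=
  Tendsto (fun n : ℕ+ => (count A n : ℝ) / (n : ℝ)) atTop (𝓝 d)

/-- A density measure: a finitely additive `[0,1]`-valued function on all sets of positive
integers that extends asymptotic density. -/
structure IsDensityMeasure (μ : Set ℕ+ → ℝ) : Prop where
  mem_unitInterval : ∀ A, μ A ∈ Set.Icc (0 : ℝ) 1
  additive : ∀ A B, Disjoint A B → μ (A ∪ B) = μ A + μ B
  extends_density : ∀ A d, HasDensity A d → μ A = d

/-- The set of all density measures, inside the space of all set functions with the product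
topology, which is the topology of setwise convergence. -/
def densityMeasures : Set (Set ℕ+ → ℝ) := {μ | IsDensityMeasure μ}

/-- A free (nonprincipal) ultrafilter: it contains every cofinite set. -/
def IsFree (F : Ultrafilter ℕ+) : Prop := (F : Filter ℕ+) ≤ cofinite

theorem isFree_iff (F : Ultrafilter ℕ+) : IsFree F ↔ ∀ n : ℕ+, F ≠ pure n := by
  constructor
  · rintro h n rfl
    have h1 : ({n}ᶜ : Set ℕ+) ∈ (pure n : Ultrafilter ℕ+) :=
      h (Set.finite_singleton n).compl_mem_cofinite
    exact h1 rfl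
  · intro h
    rcases F.le_cofinite_or_eq_pure with h1 | ⟨n, h1⟩
    · exact h1
    · exact absurd h1 (h n)

/-- The limit of a bounded real sequence along an ultrafilter. -/
def ultraLim (F : Ultrafilter ℕ+) (x : ℕ+ → ℝ) : ℝ := limUnder (F : Filter ℕ+) x

/-- Every bounded real sequence does converge to its limit along an ultrafilter. -/
theorem tendsto_ultraLim (F : Ultrafilter ℕ+) (x : ℕ+ → ℝ) (C : ℝ) (h : ∀ n, |x n| ≤ C) :
    Tendsto x F (𝓝 (ultraLim F x)) := by
  have hle : ((F.map x : Ultrafilter ℝ) : Filter ℝ) ≤ 𝓟 (Set.Icc (-C) C) := by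
    rw [le_principal_iff, Ultrafilter.coe_map, mem_map]
    exact Filter.univ_mem' fun n => abs_le.mp (h n)
  obtain ⟨L, -, hL⟩ := isCompact_Icc.ultrafilter_le_nhds (F.map x) hle
  exact tendsto_nhds_limUnder ⟨L, hL⟩

/-- `Θ_{θ,n}(x) = (∑_{θn < i ≤ n} x_i) / (n (1 - θ))`. -/
def Theta (θ : ℝ) (n : ℕ+) (x : ℕ+ → ℝ) : ℝ :=
  (∑ i ∈ (Finset.Icc 1 n).filter (fun i : ℕ+ => θ * (n : ℝ) < (i : ℝ)), x i) /
    ((n : ℝ) * (1 - θ))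

/-- `μ_G(A) = F-lim_k G-lim_n Θ_{θ_k,n}(χ_A)`. -/
def ultraMeasure (θ : ℕ+ → ℝ) (F G : Ultrafilter ℕ+) (A : Set ℕ+) : ℝ :=
  ultraLim F fun k => ultraLim G fun n => Theta (θ k) n (A.indicator 1)

end DensityMeasures

end

open Filter Topology

noncomputable section

namespace DensityMeasures

/-! ### Convexity -/

/-! If a density measure `μ` lay outside the closed convex hull of `S`, Hahn–Banach would give a
continuous functional bounded by some `u` on the hull and exceeding `u` at `μ`. Such a functional is
`ν ↦ ∑ a i * ν (A i)` over finitely many sets, i.e. integration of the simple sequence `x = ∑ a i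
χ_{A i}`. The contradiction is a dichotomy on `AveragesLE x u`.

If it holds, every density measure integrates `x` to at most `u`
(`IsDensityMeasure.sum_le_of_averagesLE`). After shifting and scaling, `x` is fed into a queue with
service rate equal to the bound. The queue length is `o(n)`, so arrivals are dominated by increments
of a sequence of linear growth. Rounded to integers, these increments are distributed among finitely
many sets having a density, on which all density measures agree.

If it fails, there are infinitely many `n` such that all averages over short intervals ending at `n`
are at least `u` (`exists_infinite_of_not_averagesLE`). A free ultrafilter `G` containing these `n`
yields an element of `S` whose integral is at least `u` (`exists_le_sum_ultraMeasure`).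

The extreme points then lie in `closure S` by Milman's theorem, as the density measures form a
compact set. -/

theorem isCompact_convexHull_union {E : Type*} [AddCommGroup E] [Module ℝ E] [TopologicalSpace E]
    [IsTopologicalAddGroup E] [ContinuousSMul ℝ E] {s t : Set E} (hs : IsCompact s)
    (ht : IsCompact t) (hs' : Convex ℝ s) (ht' : Convex ℝ t) :
    IsCompact (convexHull ℝ (s ∪ t)) := by
  rcases s.eq_empty_or_nonempty with rfl | hs0
  · simpa [ht'.convexHull_eq] using ht
  rcases t.eq_empty_or_nonempty with rfl | ht0
  · simpa [hs'.convexHull_eq] using hs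
  rw [hs'.convexHull_union ht' hs0 ht0]
  have himage : convexJoin ℝ s t =
      (fun p : ℝ × E × E => (1 - p.1) • p.2.1 + p.1 • p.2.2) '' (Set.Icc 0 1 ×ˢ s ×ˢ t) := by
    ext x
    simp only [mem_convexJoin, segment_eq_image, Set.mem_image, Prod.exists, Set.mem_prod]
    constructor
    · rintro ⟨a, ha, b, hb, r, hr, rfl⟩
      exact ⟨r, a, b, ⟨hr, ha, hb⟩, rfl⟩
    · rintro ⟨r, a, b, ⟨hr, ha, hb⟩, rfl⟩
      exact ⟨a, ha, b, hb, r, hr, rfl⟩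
  rw [himage]
  exact (isCompact_Icc.prod (hs.prod ht)).image (by fun_prop)

/-- **Milman's theorem**: the extreme points of a compact closed convex hull of `s` lie in the
closure of `s`. -/
theorem extremePoints_closedConvexHull_subset_closure {E : Type*} [AddCommGroup E] [Module ℝ E]
    [TopologicalSpace E] [IsTopologicalAddGroup E] [ContinuousSMul ℝ E] [LocallyConvexSpace ℝ E]
    [T2Space E] {s : Set E} (hs : IsCompact (closedConvexHull ℝ s)) :
    (closedConvexHull ℝ s).extremePoints ℝ ⊆ closure s := by
  intro e he
  by_contra hes
  set D := closedConvexHull ℝ s with hD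
  have hconv : Convex ℝ (D \ {e}) :=
    (convex_closedConvexHull.mem_extremePoints_iff_convex_sdiff.1 he).2
  have hclosure : IsCompact (closure s) :=
    hs.of_isClosed_subset isClosed_closure closure_subset_closedConvexHull
  obtain ⟨C, hC, hCconv, hCD, hsC⟩ : ∃ C : Set E, IsCompact C ∧ Convex ℝ C ∧ C ⊆ D \ {e} ∧
      closure s ∩ D ⊆ C := by
    -- Compactness induction: a finite cover of `closure s` by half-spaces missing `e` is merged
    -- into one compact convex set that still misses `e`, because `D \ {e}` is convex.
    refine hclosure.induction_on (p := fun t => ∃ C : Set E, IsCompact C ∧ Convex ℝ C ∧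
      C ⊆ D \ {e} ∧ t ∩ D ⊆ C) ?_ ?_ ?_ ?_
    · exact ⟨∅, isCompact_empty, convex_empty, Set.empty_subset _, by simp⟩
    · rintro t u htu ⟨C, h1, h2, h3, h4⟩
      exact ⟨C, h1, h2, h3, (Set.inter_subset_inter_left _ htu).trans h4⟩
    · rintro t u ⟨C, h1, h2, h3, h4⟩ ⟨C', h1', h2', h3', h4'⟩
      refine ⟨convexHull ℝ (C ∪ C'), isCompact_convexHull_union h1 h1' h2 h2',
        convex_convexHull ℝ _, convexHull_min (Set.union_subset h3 h3') hconv, ?_⟩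
      rw [Set.union_inter_distrib_right]
      exact (Set.union_subset_union h4 h4').trans (subset_convexHull ℝ _)
    · intro x hx
      have hxe : x ≠ e := fun h => hes (h ▸ hx)
      obtain ⟨f, hf⟩ := geometric_hahn_banach_point_point hxe
      obtain ⟨r, hr1, hr2⟩ := exists_between hf
      have hclosed : IsClosed {y | f y ≤ r} := isClosed_le f.continuous continuous_const
      refine ⟨{y | f y ≤ r}, mem_nhdsWithin_of_mem_nhds ?_, {y | f y ≤ r} ∩ D,
        hs.inter_left hclosed, ?_, ?_, subset_rfl⟩
      · exact mem_of_superset ((isOpen_lt f.continuous continuous_const).mem_nhds hr1)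
          fun y (hy : f y < r) => hy.le
      · exact (convex_halfSpace_le f.toLinearMap.isLinear r).inter convex_closedConvexHull
      · rintro y ⟨hy, hyD⟩
        refine ⟨hyD, ?_⟩
        rintro rfl
        exact absurd hy (not_le.2 hr2)
  have hDC : D ⊆ C := closedConvexHull_min
    (fun y hy => hsC ⟨subset_closure hy, subset_closedConvexHull hy⟩) hCconv hC.isClosed
  exact (hCD (hDC he.1)).2 rfl

/-- A continuous linear functional on a product of lines depends on finitely many coordinates. -/
theorem exists_finset_sum_eq {ι : Type*} (f : (ι → ℝ) →L[ℝ] ℝ) :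
    ∃ (I : Finset ι) (c : ι → ℝ), ∀ v, f v = ∑ i ∈ I, c i * v i := by
  classical
  have h0 : f ⁻¹' Set.Ioo (-1) 1 ∈ 𝓝 (0 : ι → ℝ) :=
    f.continuous.continuousAt.preimage_mem_nhds
      (by simpa using Ioo_mem_nhds (by norm_num) (by norm_num))
  rw [nhds_pi, Filter.mem_pi] at h0
  obtain ⟨I, hI, t, ht, hsub⟩ := h0
  have hker : ∀ v : ι → ℝ, (∀ i ∈ I, v i = 0) → f v = 0 := by
    intro v hv
    by_contra hne
    -- Vectors vanishing on `I` stay in the basic neighbourhood under every scaling; this one is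
    -- scaled to have value 2, outside `(-1, 1)`.
    have hmem : (2 / f v) • v ∈ f ⁻¹' Set.Ioo (-1) 1 := by
      refine hsub fun i hi => ?_
      simpa [hv i hi] using mem_of_mem_nhds (ht i)
    have : (2 / f v) * f v < 1 := by simpa using hmem.2
    rw [div_mul_cancel₀ _ hne] at this
    norm_num at this
  refine ⟨hI.toFinset, fun i => f (Pi.single i 1), fun v => ?_⟩
  have hz := hker (v - ∑ i ∈ hI.toFinset, v i • Pi.single i 1) (by
    intro j hj
    have hj' : j ∈ hI.toFinset := by simpa using hj
    simp [Finset.sum_apply, Pi.single_apply, hj])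
  rw [map_sub, map_sum, sub_eq_zero] at hz
  rw [hz]
  exact Finset.sum_congr rfl fun i _ => by rw [map_smul, smul_eq_mul, mul_comm]

/-! ### Finite additivity -/

theorem IsDensityMeasure.inter_add_diff {μ : Set ℕ+ → ℝ} (h : IsDensityMeasure μ)
    (C A : Set ℕ+) : μ (C ∩ A) + μ (C \ A) = μ C := by
  rw [← h.additive _ _ (Set.disjoint_sdiff_inter.symm), Set.inter_union_sdiff]

/-- Induction on the number of sets: `C` is cut along `A i`, and on `C ∩ A i` the coefficient `a i`
is absorbed into `b`. Hence `b` and `C` must stay general. -/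
theorem IsDensityMeasure.sum_nonneg_aux {μ : Set ℕ+ → ℝ} (h : IsDensityMeasure μ) {ι : Type*}
    (s : Finset ι) (a : ι → ℝ) (A : ι → Set ℕ+) : ∀ (b : ℝ) (C : Set ℕ+),
    (∀ n ∈ C, 0 ≤ b + ∑ i ∈ s, a i * (A i).indicator 1 n) →
    0 ≤ b * μ C + ∑ i ∈ s, a i * μ (C ∩ A i) := by
  classical
  induction s using Finset.induction_on with
  | empty =>
    intro b C hC
    rcases C.eq_empty_or_nonempty with rfl | ⟨n, hn⟩
    · have := h.additive ∅ ∅ (by simp)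
      have h0 : μ ∅ = 0 := by simpa using this
      simp [h0]
    · have hb : 0 ≤ b := by simpa using hC n hn
      simpa using mul_nonneg hb (h.mem_unitInterval C).1
  | insert i s hi ih =>
    intro b C hC
    have h1 := ih (b + a i) (C ∩ A i) (by
      rintro n ⟨hn, hni⟩
      have := hC n hn
      rw [Finset.sum_insert hi, Set.indicator_of_mem hni] at this
      simp only [Pi.one_apply] at this
      linarith)
    have h2 := ih b (C \ A i) (by
      rintro n ⟨hn, hni⟩
      have := hC n hn
      rw [Finset.sum_insert hi, Set.indicator_of_notMem hni] at this
      linarith)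
    have h3 : ∑ j ∈ s, a j * μ (C ∩ A j) =
        ∑ j ∈ s, a j * μ (C ∩ A i ∩ A j) + ∑ j ∈ s, a j * μ (C \ A i ∩ A j) := by
      rw [← Finset.sum_add_distrib]
      refine Finset.sum_congr rfl fun j _ => ?_
      rw [← mul_add, ← h.inter_add_diff (C ∩ A j) (A i), Set.inter_right_comm,
        Set.inter_sdiff_right_comm]
    rw [Finset.sum_insert hi, h3, ← h.inter_add_diff C (A i)]
    linarith

/-- A density measure is monotone on linear combinations of indicator functions. -/
theorem IsDensityMeasure.sum_le_sum {μ : Set ℕ+ → ℝ} (h : IsDensityMeasure μ) {ι κ : Type*}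
    (s : Finset ι) (a : ι → ℝ) (A : ι → Set ℕ+) (t : Finset κ) (b : κ → ℝ) (B : κ → Set ℕ+)
    (r : ℝ) (hle : ∀ n, r + ∑ i ∈ s, a i * (A i).indicator 1 n ≤
      ∑ j ∈ t, b j * (B j).indicator 1 n) :
    r * μ Set.univ + ∑ i ∈ s, a i * μ (A i) ≤ ∑ j ∈ t, b j * μ (B j) := by
  have := h.sum_nonneg_aux (s.disjSum t) (Sum.elim (fun i => -a i) b) (Sum.elim A B) (-r)
    Set.univ (by
      intro n _
      have := hle n
      simp only [Finset.sum_disjSum, Sum.elim_inl, Sum.elim_inr, neg_mul, Finset.sum_neg_distrib]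
      linarith)
  simp only [Finset.sum_disjSum, Sum.elim_inl, Sum.elim_inr, neg_mul, Finset.sum_neg_distrib,
    Set.univ_inter] at this
  linarith

/-! ### Partial sums and densities -/

/-- The sum of the first `n` terms of a sequence indexed by the positive integers. -/
def partialSum (x : ℕ+ → ℝ) (n : ℕ) : ℝ := ∑ i ∈ Finset.range n, x i.succPNat

@[simp] theorem partialSum_zero (x : ℕ+ → ℝ) : partialSum x 0 = 0 := by simp [partialSum]

theorem partialSum_succ (x : ℕ+ → ℝ) (n : ℕ) :
    partialSum x (n + 1) = partialSum x n + x n.succPNat := by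
  simp [partialSum, Finset.sum_range_succ]

theorem sum_filter_lt_eq_sub (x : ℕ+ → ℝ) (n : ℕ+) {t : ℕ} (h : t ≤ n) :
    ∑ i ∈ (Finset.Icc 1 n).filter (fun i : ℕ+ => t < (i : ℕ)), x i =
      partialSum x n - partialSum x t := by
  rw [partialSum, partialSum, ← Finset.sum_Ico_eq_sub _ h]
  refine Finset.sum_nbij' PNat.natPred Nat.succPNat ?_ ?_ ?_ ?_ ?_
  · intro i hi
    simp only [Finset.mem_filter, Finset.mem_Icc] at hi
    have h1 : (i : ℕ) ≤ n := hi.1.2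
    have h2 := PNat.natPred_add_one i
    simp only [Finset.mem_Ico]
    omega
  · intro i hi
    simp only [Finset.mem_Ico] at hi
    refine Finset.mem_filter.2 ⟨Finset.mem_Icc.2 ⟨one_le, PNat.coe_le_coe _ _ |>.1 ?_⟩, ?_⟩ <;>
      rw [Nat.succPNat_coe] <;> omega
  · intro i _; simp
  · intro i _; simp
  · intro i _; simp

theorem count_eq_partialSum (A : Set ℕ+) (n : ℕ+) :
    (count A n : ℝ) = partialSum (A.indicator 1) n := by
  classical
  have h := sum_filter_lt_eq_sub (A.indicator 1) n (Nat.zero_le _)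
  rw [partialSum_zero, sub_zero] at h
  rw [← h, Finset.filter_true_of_mem (fun i _ => i.pos)]
  have : A ∩ Set.Icc 1 n = ((Finset.Icc 1 n).filter (· ∈ A) : Finset ℕ+) := by
    ext i; simp [and_comm]
  rw [count, this, Set.ncard_coe_finset, Finset.card_filter, Nat.cast_sum]
  refine Finset.sum_congr rfl fun i _ => ?_
  by_cases hi : i ∈ A <;> simp [hi]

theorem tendsto_coe_atTop : Tendsto (fun n : ℕ+ => (n : ℕ)) atTop atTop :=
  tendsto_atTop.2 fun b => by
    filter_upwards [eventually_ge_atTop b.succPNat] with n hn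
    have : (b.succPNat : ℕ) ≤ n := hn
    simp only [Nat.succPNat_coe] at this
    omega

theorem tendsto_succPNat_atTop : Tendsto Nat.succPNat atTop atTop :=
  tendsto_atTop.2 fun b => by
    filter_upwards [eventually_ge_atTop (b : ℕ)] with n hn
    rw [← PNat.coe_le_coe, Nat.succPNat_coe]
    omega

theorem hasDensity_iff (A : Set ℕ+) (d : ℝ) :
    HasDensity A d ↔ Tendsto (fun n : ℕ => partialSum (A.indicator 1) n / n) atTop (𝓝 d) := by
  unfold HasDensity
  simp only [count_eq_partialSum]
  constructor
  · intro h
    rw [← tendsto_add_atTop_iff_nat 1]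
    refine (h.comp tendsto_succPNat_atTop).congr fun n => ?_
    simp only [Function.comp_apply, Nat.succPNat_coe, Nat.succ_eq_add_one]
  · intro h
    refine (h.comp tendsto_coe_atTop).congr fun n => ?_
    simp only [Function.comp_apply]

theorem partialSum_indicator_univ (n : ℕ) : partialSum (Set.univ.indicator 1) n = n := by
  simp [partialSum]

theorem hasDensity_univ : HasDensity Set.univ 1 := by
  rw [hasDensity_iff]
  refine tendsto_const_nhds.congr' ?_
  filter_upwards [eventually_gt_atTop 0] with n hn
  rw [partialSum_indicator_univ, div_self (by positivity)]

theorem IsDensityMeasure.univ {μ : Set ℕ+ → ℝ} (h : IsDensityMeasure μ) : μ Set.univ = 1 :=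
  h.extends_density _ _ hasDensity_univ

/-! ### Sets of jumps -/

/-- Hermite's identity: passing from `p` to `p + 1` drops the term `p / Q` and adds `(p + Q) / Q = p
/ Q + 1`. -/
theorem sum_range_add_div (Q : ℕ) (hQ : 0 < Q) (p : ℕ) :
    ∑ l ∈ Finset.range Q, (p + l) / Q = p := by
  induction p with
  | zero =>
    refine Finset.sum_eq_zero fun l hl => ?_
    rw [zero_add, Nat.div_eq_of_lt (Finset.mem_range.1 hl)]
  | succ p ih =>
    have h1 := Finset.sum_range_succ (fun l => (p + l) / Q) Q
    have h2 := Finset.sum_range_succ' (fun l => (p + l) / Q) Q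
    rw [h2, ih, Nat.add_div_right _ hQ] at h1
    simp only [add_zero] at h1
    have h3 : ∑ l ∈ Finset.range Q, (p + 1 + l) / Q = ∑ l ∈ Finset.range Q, (p + (l + 1)) / Q :=
      Finset.sum_congr rfl fun l _ => by rw [add_assoc, add_comm 1 l]
    omega

/-- The places where `⌊(p + l) / Q⌋` increases. -/
def jumpSet (p : ℕ → ℕ) (Q l : ℕ) : Set ℕ+ :=
  {n | (p n.natPred + l) / Q < (p n + l) / Q}

/-- Since `p` grows by at most `Q` per step, the quotient jumps by 0 or 1, so its increment is an
indicator. -/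
theorem indicator_jumpSet {p : ℕ → ℕ} {Q : ℕ} (hQ : 0 < Q) (hp : Monotone p)
    (hpQ : ∀ n, p (n + 1) ≤ p n + Q) (l n : ℕ) :
    (jumpSet p Q l).indicator (1 : ℕ+ → ℝ) n.succPNat =
      (((p (n + 1) + l) / Q : ℕ) : ℝ) - ((p n + l) / Q : ℕ) := by
  have h1 : (p n + l) / Q ≤ (p (n + 1) + l) / Q :=
    Nat.div_le_div_right (Nat.add_le_add_right (hp n.le_succ) l)
  have h2 : (p (n + 1) + l) / Q ≤ (p n + l) / Q + 1 := by
    rw [← Nat.add_div_right _ hQ]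
    exact Nat.div_le_div_right (by have := hpQ n; omega)
  by_cases h : (p n + l) / Q < (p (n + 1) + l) / Q
  · have hmem : n.succPNat ∈ jumpSet p Q l := by simpa [jumpSet] using h
    rw [Set.indicator_of_mem hmem, show (p (n + 1) + l) / Q = (p n + l) / Q + 1 by omega]
    simp
  · have hmem : n.succPNat ∉ jumpSet p Q l := by simpa [jumpSet] using h
    rw [Set.indicator_of_notMem hmem, show (p (n + 1) + l) / Q = (p n + l) / Q by omega]
    simp

theorem partialSum_jumpSet {p : ℕ → ℕ} {Q : ℕ} (hQ : 0 < Q) (hp : Monotone p) (hp0 : p 0 = 0)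
    (hpQ : ∀ n, p (n + 1) ≤ p n + Q) {l : ℕ} (hl : l < Q) (n : ℕ) :
    partialSum ((jumpSet p Q l).indicator 1) n = ((p n + l) / Q : ℕ) := by
  induction n with
  | zero => simp [hp0, Nat.div_eq_of_lt hl]
  | succ n ih => rw [partialSum_succ, ih, indicator_jumpSet hQ hp hpQ]; ring

theorem sum_indicator_jumpSet {p : ℕ → ℕ} {Q : ℕ} (hQ : 0 < Q) (hp : Monotone p)
    (hpQ : ∀ n, p (n + 1) ≤ p n + Q) (n : ℕ) :
    ∑ l ∈ Finset.range Q, (jumpSet p Q l).indicator (1 : ℕ+ → ℝ) n.succPNat =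
      (p (n + 1) : ℝ) - p n := by
  simp only [indicator_jumpSet hQ hp hpQ, Finset.sum_sub_distrib]
  rw [← Nat.cast_sum, ← Nat.cast_sum, sum_range_add_div Q hQ, sum_range_add_div Q hQ]

theorem hasDensity_jumpSet {p : ℕ → ℕ} {Q : ℕ} (hQ : 0 < Q) (hp : Monotone p) (hp0 : p 0 = 0)
    (hpQ : ∀ n, p (n + 1) ≤ p n + Q) {l : ℕ} (hl : l < Q) {c : ℝ}
    (hc : Tendsto (fun n : ℕ => (p n : ℝ) / n) atTop (𝓝 c)) :
    HasDensity (jumpSet p Q l) (c / Q) := by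
  rw [hasDensity_iff]
  have hQ' : (0 : ℝ) < Q := by exact_mod_cast hQ
  simp only [partialSum_jumpSet hQ hp hp0 hpQ hl]
  have hinv : Tendsto (fun n : ℕ => 1 / (n : ℝ)) atTop (𝓝 0) := tendsto_one_div_atTop_nhds_zero_nat
  have hlow : Tendsto (fun n : ℕ => (p n : ℝ) / n / Q - 1 / (n : ℝ)) atTop (𝓝 (c / Q)) := by
    simpa using (hc.div_const (Q : ℝ)).sub hinv
  have hupp : Tendsto (fun n : ℕ => (p n : ℝ) / n / Q + 1 / (n : ℝ)) atTop (𝓝 (c / Q)) := by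
    simpa using (hc.div_const (Q : ℝ)).add hinv
  have hkey : ∀ n, (p n : ℝ) / Q - 1 ≤ ((p n + l) / Q : ℕ) ∧
      (((p n + l) / Q : ℕ) : ℝ) ≤ (p n : ℝ) / Q + 1 := by
    intro n
    have h1 : p n ≤ (p n + l) / Q * Q + Q := by
      have := Nat.div_add_mod (p n + l) Q
      have := Nat.mod_lt (p n + l) hQ
      rw [mul_comm]; omega
    have h2 : (p n + l) / Q * Q ≤ p n + Q := (Nat.div_mul_le_self _ _).trans (by omega)
    have h1' : (p n : ℝ) ≤ ((p n + l) / Q : ℕ) * Q + Q := by exact_mod_cast h1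
    have h2' : (((p n + l) / Q : ℕ) : ℝ) * Q ≤ p n + Q := by exact_mod_cast h2
    constructor
    · rw [sub_le_iff_le_add, div_le_iff₀ hQ']; linarith
    · rw [← sub_le_iff_le_add, le_div_iff₀ hQ']; linarith
  refine tendsto_of_tendsto_of_tendsto_of_le_of_le' hlow hupp ?_ ?_
  · filter_upwards with n
    calc (p n : ℝ) / n / Q - 1 / n = (p n / Q - 1) / n := by ring
      _ ≤ _ := by gcongr; exact (hkey n).1
  · filter_upwards with n
    calc _ ≤ ((p n : ℝ) / Q + 1) / n := by gcongr; exact (hkey n).2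
      _ = _ := by ring

/-! ### Queues -/

/-- The length of a queue with arrivals `z` and service rate `c`. -/
def queue (z : ℕ+ → ℝ) (c : ℝ) : ℕ → ℝ
  | 0 => 0
  | n + 1 => max (queue z c n + z n.succPNat - c) 0

theorem queue_nonneg (z : ℕ+ → ℝ) (c : ℝ) : ∀ n, 0 ≤ queue z c n
  | 0 => le_rfl
  | _ + 1 => le_max_right _ _

/-- Here `m` is the last time the maximum with 0 reset the queue, or 0; from then on the recursion
is linear. -/
theorem exists_queue_eq (z : ℕ+ → ℝ) (c : ℝ) (n : ℕ) : ∃ m ≤ n,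
    queue z c n = partialSum z n - partialSum z m - c * (n - m) := by
  induction n with
  | zero => exact ⟨0, le_rfl, by simp [queue]⟩
  | succ n ih =>
    obtain ⟨m, hm, h⟩ := ih
    rcases max_choice (queue z c n + z n.succPNat - c) 0 with h' | h'
    · refine ⟨m, by omega, ?_⟩
      rw [queue, h', h, partialSum_succ]
      push_cast; ring
    · exact ⟨n + 1, le_rfl, by rw [queue, h']; ring⟩

/-- The averages of `x` over long intervals are asymptotically at most `c`. -/
def AveragesLE (x : ℕ+ → ℝ) (c : ℝ) : Prop :=
  ∀ ε > 0, ∀ᶠ n : ℕ in atTop, ∀ m ≤ n, partialSum x n - partialSum x m ≤ c * (n - m) + ε * n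

theorem AveragesLE.tendsto_queue {z : ℕ+ → ℝ} {c : ℝ} (h : AveragesLE z c) :
    Tendsto (fun n : ℕ => queue z c n / n) atTop (𝓝 0) := by
  rw [Metric.tendsto_atTop]
  intro ε hε
  obtain ⟨N, hN⟩ := eventually_atTop.1 (h (ε / 2) (half_pos hε))
  refine ⟨N + 1, fun n hn => ?_⟩
  obtain ⟨m, hm, hq⟩ := exists_queue_eq z c n
  have hn0 : (0 : ℝ) < n := by exact_mod_cast (by omega : 0 < n)
  have := hN n (by omega) m hm
  rw [Real.dist_eq, sub_zero, abs_of_nonneg (div_nonneg (queue_nonneg z c n) hn0.le),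
    div_lt_iff₀ hn0]
  nlinarith

/-- A sequence whose averages are asymptotically at most `c` is dominated, up to an error `1`, by a
sum of indicators of sets whose densities add up to `c`. -/
theorem AveragesLE.exists_jumpSets {z : ℕ+ → ℝ} {c L : ℝ} (h : AveragesLE z c) (hc : 0 ≤ c)
    (hz : ∀ n, z n ∈ Set.Icc 0 L) : ∃ (Q : ℕ) (E : ℕ → Set ℕ+), 0 < Q ∧
      (∀ l < Q, HasDensity (E l) (c / Q)) ∧
      ∀ n, z n - 1 ≤ ∑ l ∈ Finset.range Q, (E l).indicator 1 n := by
  -- Service plus backlog: each increment is at least the arrival `z`, while `P n / n` tends to `c`.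
  set P : ℕ → ℝ := fun n => c * n + queue z c n with hP
  have hstep : ∀ n, P n + z n.succPNat ≤ P (n + 1) ∧ P (n + 1) ≤ P n + max L c := by
    intro n
    have h1 : queue z c (n + 1) = max (queue z c n + z n.succPNat - c) 0 := rfl
    have h2 := le_max_left (queue z c n + z n.succPNat - c) 0
    have h3 := queue_nonneg z c n
    have h4 := le_max_left L c
    have h5 := le_max_right L c
    have h6 := (hz n.succPNat).2
    simp only [hP, h1]
    push_cast
    refine ⟨by linarith, ?_⟩
    have : max (queue z c n + z n.succPNat - c) 0 ≤ queue z c n - c + max L c :=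
      max_le (by linarith) (by linarith)
    linarith
  have hP0 : ∀ n, 0 ≤ P n := fun n => add_nonneg (by positivity) (queue_nonneg z c n)
  have hmono : Monotone P := monotone_nat_of_le_succ fun n => by
    linarith [(hstep n).1, (hz n.succPNat).1]
  set p : ℕ → ℕ := fun n => ⌊P n⌋₊ with hp
  have hpmono : Monotone p := fun a b hab => Nat.floor_mono (hmono hab)
  have hp0 : p 0 = 0 := by simp [hp, hP, queue]
  -- The ceiling bounds the increments of `P`; the extra 1 pays for rounding down.
  set Q : ℕ := ⌈max L c⌉₊ + 1 with hQ
  have hQpos : 0 < Q := Nat.succ_pos _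
  have hpQ : ∀ n, p (n + 1) ≤ p n + Q := by
    intro n
    have h1 := Nat.floor_le (hP0 (n + 1))
    have h2 := Nat.lt_floor_add_one (P n)
    have h3 := Nat.le_ceil (max L c)
    have h4 : (p (n + 1) : ℝ) < ((p n + Q : ℕ) : ℝ) + 1 := by
      simp only [hp, hQ]; push_cast; linarith [(hstep n).2]
    have h5 : p (n + 1) < p n + Q + 1 := by exact_mod_cast h4
    omega
  have hPlim : Tendsto (fun n : ℕ => P n / n) atTop (𝓝 c) := by
    have := (tendsto_const_nhds (x := c)).add h.tendsto_queue
    rw [add_zero] at this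
    refine this.congr' ?_
    filter_upwards [eventually_gt_atTop 0] with n hn
    have : (n : ℝ) ≠ 0 := by positivity
    simp only [hP]; field_simp
  have hplim : Tendsto (fun n : ℕ => (p n : ℝ) / n) atTop (𝓝 c) := by
    have hlow : Tendsto (fun n : ℕ => P n / n - 1 / (n : ℝ)) atTop (𝓝 c) := by
      simpa using hPlim.sub tendsto_one_div_atTop_nhds_zero_nat
    refine tendsto_of_tendsto_of_tendsto_of_le_of_le hlow hPlim (fun n => ?_) fun n => ?_
    · change P n / n - 1 / n ≤ (p n : ℝ) / n
      rw [← sub_div]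
      gcongr
      linarith [Nat.lt_floor_add_one (P n)]
    · change (p n : ℝ) / n ≤ P n / n
      gcongr
      exact Nat.floor_le (hP0 n)
  refine ⟨Q, jumpSet p Q, hQpos,
    fun l hl => hasDensity_jumpSet hQpos hpmono hp0 hpQ hl hplim, fun n => ?_⟩
  obtain ⟨n, rfl⟩ : ∃ k : ℕ, n = k.succPNat := ⟨n.natPred, by simp⟩
  rw [sum_indicator_jumpSet hQpos hpmono hpQ]
  have h1 := Nat.floor_le (hP0 n)
  have h2 := Nat.lt_floor_add_one (P (n + 1))
  have h3 := (hstep n).1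
  simp only [hp]
  linarith

/-! ### Upper bound for integrals against density measures -/

theorem AveragesLE.nonneg {x : ℕ+ → ℝ} {c : ℝ} (h : AveragesLE x c) (hx : ∀ n, 0 ≤ x n) :
    0 ≤ c := by
  refine le_of_forall_pos_le_add fun ε hε => ?_
  obtain ⟨n, hn, hn0⟩ := ((h ε hε).and (eventually_gt_atTop 0)).exists
  have h1 := hn 0 n.zero_le
  have h2 : 0 ≤ partialSum x n := Finset.sum_nonneg fun i _ => hx _
  have h3 : (0 : ℝ) < n := by exact_mod_cast hn0
  rw [partialSum_zero, Nat.cast_zero] at h1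
  refine nonneg_of_mul_nonneg_left (b := (n : ℝ)) ?_ h3
  linarith

theorem partialSum_affine (x : ℕ+ → ℝ) (r b : ℝ) (n : ℕ) :
    partialSum (fun i => r * (x i + b)) n = r * (partialSum x n + b * n) := by
  simp [partialSum, ← Finset.mul_sum, Finset.sum_add_distrib, mul_comm]

theorem AveragesLE.affine {x : ℕ+ → ℝ} {c : ℝ} (h : AveragesLE x c) {r : ℝ} (hr : 0 < r)
    (b : ℝ) : AveragesLE (fun i => r * (x i + b)) (r * (c + b)) := by
  intro ε hε
  filter_upwards [h (ε / r) (by positivity)] with n hn m hm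
  have h1 := mul_le_mul_of_nonneg_left (hn m hm) hr.le
  have h2 : r * (ε / r * n) = ε * n := by field_simp
  rw [partialSum_affine, partialSum_affine]
  linarith

theorem abs_sum_indicator_le {ι : Type*} (s : Finset ι) (a : ι → ℝ) (A : ι → Set ℕ+) (n : ℕ+) :
    |∑ i ∈ s, a i * (A i).indicator 1 n| ≤ ∑ i ∈ s, |a i| := by
  refine (Finset.abs_sum_le_sum_abs _ _).trans (Finset.sum_le_sum fun i _ => ?_)
  by_cases h : n ∈ A i <;> simp [h]

/-- If the averages of a simple sequence are asymptotically at most `c`, so is its integral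
against every density measure. -/
theorem IsDensityMeasure.sum_le_of_averagesLE {μ : Set ℕ+ → ℝ} (h : IsDensityMeasure μ)
    {ι : Type*} (s : Finset ι) (a : ι → ℝ) (A : ι → Set ℕ+) {c : ℝ}
    (hc : AveragesLE (fun n => ∑ i ∈ s, a i * (A i).indicator 1 n) c) :
    ∑ i ∈ s, a i * μ (A i) ≤ c := by
  refine le_of_forall_pos_le_add fun ε hε => ?_
  -- Scaling by `r` reduces the unit rounding error of `exists_jumpSets` to `1 / r ≤ ε`; adding `L`
  -- makes the sequence nonnegative.
  obtain ⟨r, hr, hrε⟩ : ∃ r : ℝ, 0 < r ∧ 1 / r ≤ ε := ⟨1 / ε, by positivity, by simp⟩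
  set L := ∑ i ∈ s, |a i|
  have hbd := fun n => abs_le.1 (abs_sum_indicator_le s a A n)
  have hz : ∀ n, r * ((∑ i ∈ s, a i * (A i).indicator 1 n) + L) ∈ Set.Icc 0 (r * (L + L)) :=
    fun n => ⟨mul_nonneg hr.le (by linarith [(hbd n).1]),
      mul_le_mul_of_nonneg_left (by linarith [(hbd n).2]) hr.le⟩
  have hav := hc.affine hr L
  obtain ⟨Q, E, hQ, hE, hle⟩ := hav.exists_jumpSets (hav.nonneg fun n => (hz n).1) hz
  have hsum := h.sum_le_sum s (fun i => r * a i) A (Finset.range Q) (fun _ => 1) E (r * L - 1)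
    (by
      intro n
      have := hle n
      simp only [one_mul, mul_assoc, ← Finset.mul_sum]
      linarith)
  have hEsum : ∑ l ∈ Finset.range Q, 1 * μ (E l) = r * (c + L) := by
    rw [Finset.sum_congr rfl fun l hl => by
      rw [one_mul, h.extends_density _ _ (hE l (Finset.mem_range.1 hl))]]
    have : (Q : ℝ) ≠ 0 := by positivity
    simp only [Finset.sum_const, Finset.card_range, nsmul_eq_mul]
    field_simp
  rw [hEsum, h.univ] at hsum
  simp only [mul_assoc, ← Finset.mul_sum] at hsum
  have h1 : r * (1 / r) = 1 := by field_simp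
  have h2 : r * (∑ i ∈ s, a i * μ (A i)) ≤ r * (c + 1 / r) := by linarith
  linarith [le_of_mul_le_mul_left h2 hr]

theorem partialSum_sub_le {x : ℕ+ → ℝ} {L : ℝ} (hx : ∀ n, x n ≤ L) {m n : ℕ} (h : m ≤ n) :
    partialSum x n - partialSum x m ≤ L * (n - m) := by
  induction n, h using Nat.le_induction with
  | base => simp
  | succ n _ ih =>
    rw [partialSum_succ]
    push_cast
    linarith [hx n.succPNat]

/-- If the averages of `x` are not asymptotically at most `c`, then there are infinitely many `n`
such that the averages over all short intervals ending at `n` are at least `c`. -/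
theorem exists_infinite_of_not_averagesLE {x : ℕ+ → ℝ} {c L : ℝ} (hx : ∀ n, x n ≤ L)
    (h : ¬ AveragesLE x c) : ∃ δ : ℝ, 0 < δ ∧ ∃ W : Set ℕ+, W.Infinite ∧ ∀ n ∈ W, ∀ t : ℕ,
      t ≤ n → (1 - δ) * n < t + 1 → c * (n - t) ≤ partialSum x n - partialSum x t := by
  simp only [AveragesLE, not_forall, not_eventually, not_le] at h
  obtain ⟨ε, hε, h⟩ := h
  set B := |L| + |c| + 1 with hB
  have hB0 : 0 < B := by positivity
  refine ⟨ε / B, by positivity, {n : ℕ+ | ∀ t : ℕ, t ≤ n → (1 - ε / B) * n < t + 1 →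
    c * (n - t) ≤ partialSum x n - partialSum x t},
    Set.infinite_of_forall_exists_gt fun N => ?_, fun n hn => hn⟩
  obtain ⟨n, hn, hnN⟩ := (h.and_eventually
    ((tendsto_natCast_atTop_atTop (R := ℝ)).eventually_gt_atTop (N * B / ε))).exists
  obtain ⟨m, hm, hmn⟩ := hn
  -- At a maximum of `partialSum x t - c * t`, every interval ending at `k` and starting in `[m, k]`
  -- has average at least `c`. The excess `ε * n` accrues at a rate of at most `B`, so `k - m ≥ ε *
  -- n / B`. Thus `k` is large, and `[m, k]` covers a proportion `ε / B` of `k`.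
  obtain ⟨k, hk, hmax⟩ := (Finset.Icc m n).exists_max_image (fun t => partialSum x t - c * t)
    ⟨n, Finset.mem_Icc.2 ⟨hm, le_rfl⟩⟩
  rw [Finset.mem_Icc] at hk
  have h1 := hmax n (Finset.mem_Icc.2 ⟨hm, le_rfl⟩)
  have h2 := partialSum_sub_le hx hk.1
  have hmk : (m : ℝ) ≤ k := by exact_mod_cast hk.1
  have hkn : (k : ℝ) ≤ n := by exact_mod_cast hk.2
  have hm0 : (0 : ℝ) ≤ m := by positivity
  have h3 : ε * n ≤ B * (k - m) := by
    have e1 : L * (k - m) ≤ |L| * (k - m) :=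
      mul_le_mul_of_nonneg_right (le_abs_self L) (by linarith)
    have e2 : -c * (k - m) ≤ |c| * (k - m) :=
      mul_le_mul_of_nonneg_right (neg_le_abs c) (by linarith)
    rw [hB]; nlinarith
  have hNk : (N : ℝ) < k := by
    rw [div_lt_iff₀ hε] at hnN
    have : (N : ℝ) * B < k * B := by nlinarith
    exact lt_of_mul_lt_mul_right this hB0.le
  have hNk' : (N : ℕ) < k := by exact_mod_cast hNk
  have hk0 : 0 < k := by omega
  refine ⟨⟨k, hk0⟩, ?_, (PNat.coe_lt_coe _ _).1 hNk'⟩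
  intro t ht htk
  simp only [PNat.mk_coe] at ht htk ⊢
  have hmt : m ≤ t := by
    have : ε / B * k ≤ k - m := by
      rw [div_mul_eq_mul_div, div_le_iff₀ hB0]
      nlinarith
    have h4 : (m : ℝ) < (t + 1 : ℕ) := by push_cast; linarith
    have h5 : m < t + 1 := by exact_mod_cast h4
    omega
  have := hmax t (Finset.mem_Icc.2 ⟨hmt, ht.trans hk.2⟩)
  linarith

/-! ### The functionals `Theta` and their limits -/

theorem Theta_eq {θ : ℝ} (hθ : θ ∈ Set.Ioo (0 : ℝ) 1) (n : ℕ+) (x : ℕ+ → ℝ) :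
    Theta θ n x = (partialSum x n - partialSum x ⌊θ * (n : ℝ)⌋₊) / ((n : ℝ) * (1 - θ)) := by
  have hn : (0 : ℝ) < n := by exact_mod_cast n.pos
  have hpos : 0 ≤ θ * (n : ℝ) := mul_nonneg hθ.1.le hn.le
  have hle : ⌊θ * (n : ℝ)⌋₊ ≤ n := Nat.floor_le_of_le (by nlinarith [hθ.2])
  rw [Theta, ← sum_filter_lt_eq_sub x n hle]
  simp only [Nat.floor_lt hpos]

theorem Theta_sum {ι : Type*} (s : Finset ι) (a : ι → ℝ) (x : ι → ℕ+ → ℝ) (θ : ℝ) (n : ℕ+) :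
    Theta θ n (fun i => ∑ j ∈ s, a j * x j i) = ∑ j ∈ s, a j * Theta θ n (x j) := by
  simp only [Theta]
  rw [Finset.sum_comm, Finset.sum_div]
  refine Finset.sum_congr rfl fun j _ => ?_
  rw [← Finset.mul_sum, mul_div_assoc]

theorem Theta_mono {θ : ℝ} (hθ : θ ∈ Set.Ioo (0 : ℝ) 1) (n : ℕ+) {x y : ℕ+ → ℝ} (h : x ≤ y) :
    Theta θ n x ≤ Theta θ n y := by
  have : 0 < 1 - θ := sub_pos.2 hθ.2
  have hn : (0 : ℝ) < n := by exact_mod_cast n.pos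
  unfold Theta
  gcongr with i
  exact h i

theorem indicator_one_le_univ (A : Set ℕ+) :
    A.indicator (1 : ℕ+ → ℝ) ≤ Set.univ.indicator 1 := by
  intro i
  by_cases h : i ∈ A <;> simp [h]

theorem Theta_indicator_nonneg {θ : ℝ} (hθ : θ ∈ Set.Ioo (0 : ℝ) 1) (n : ℕ+) (A : Set ℕ+) :
    0 ≤ Theta θ n (A.indicator 1) := by
  have : 0 < 1 - θ := sub_pos.2 hθ.2
  have hn : (0 : ℝ) < n := by exact_mod_cast n.pos
  exact div_nonneg (Finset.sum_nonneg fun i _ => Set.indicator_nonneg (fun _ _ => zero_le_one) _)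
    (by positivity)

/-- A crude bound, needed only for the ultrafilter limit to exist: the number of terms can exceed `n
* (1 - θ)`, so 1 is not a bound for fixed `n`. -/
theorem abs_Theta_indicator_le {θ : ℝ} (hθ : θ ∈ Set.Ioo (0 : ℝ) 1) (n : ℕ+) (A : Set ℕ+) :
    |Theta θ n (A.indicator 1)| ≤ 1 / (1 - θ) := by
  have h1 : 0 < 1 - θ := sub_pos.2 hθ.2
  have hn : (0 : ℝ) < n := by exact_mod_cast n.pos
  rw [abs_of_nonneg (Theta_indicator_nonneg hθ n A)]
  refine (Theta_mono hθ n (indicator_one_le_univ A)).trans ?_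
  rw [Theta_eq hθ, partialSum_indicator_univ, partialSum_indicator_univ,
    div_le_div_iff₀ (by positivity) h1]
  have : (0 : ℝ) ≤ ⌊θ * (n : ℝ)⌋₊ := by positivity
  nlinarith

theorem tendsto_Theta {θ : ℝ} (hθ : θ ∈ Set.Ioo (0 : ℝ) 1) {A : Set ℕ+} {d : ℝ}
    (h : HasDensity A d) : Tendsto (fun n => Theta θ n (A.indicator 1)) atTop (𝓝 d) := by
  have h1 : 1 - θ ≠ 0 := (sub_pos.2 hθ.2).ne'
  rw [hasDensity_iff] at h
  have hfl : Tendsto (fun n : ℕ => (⌊θ * (n : ℝ)⌋₊ : ℝ) / n) atTop (𝓝 θ) :=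
    (tendsto_nat_floor_mul_div_atTop hθ.1.le).comp tendsto_natCast_atTop_atTop
  have hfl' : Tendsto (fun n : ℕ => ⌊θ * (n : ℝ)⌋₊) atTop atTop :=
    tendsto_nat_floor_atTop.comp (tendsto_natCast_atTop_atTop.const_mul_atTop hθ.1)
  have hmain : Tendsto (fun n : ℕ => (partialSum (A.indicator 1) n / n -
      partialSum (A.indicator 1) ⌊θ * (n : ℝ)⌋₊ / ⌊θ * (n : ℝ)⌋₊ * (⌊θ * (n : ℝ)⌋₊ / n)) / (1 - θ))
      atTop (𝓝 ((d - d * θ) / (1 - θ))) :=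
    (h.sub ((h.comp hfl').mul hfl)).div_const _
  have hd : (d - d * θ) / (1 - θ) = d := by field_simp
  rw [hd] at hmain
  refine (hmain.comp tendsto_coe_atTop).congr fun n => ?_
  have hn : (n : ℝ) ≠ 0 := by exact_mod_cast n.ne_zero
  rw [Function.comp_apply, Theta_eq hθ]
  generalize ⌊θ * (n : ℝ)⌋₊ = t
  -- For `t = 0` the quotient by `t` is the default 0, which agrees with the empty partial sum.
  by_cases hz : (t : ℝ) = 0
  · have hz' : t = 0 := by exact_mod_cast hz
    rw [hz', partialSum_zero]
    field_simp
    simp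
  · field_simp

theorem IsFree.le_atTop {G : Ultrafilter ℕ+} (h : IsFree G) : (G : Filter ℕ+) ≤ atTop := by
  refine le_trans h (le_iInf fun n => le_principal_iff.2 ?_)
  rw [mem_cofinite, Set.compl_Ici]
  exact Set.finite_Iio n

theorem exists_isFree_mem {W : Set ℕ+} (hW : W.Infinite) :
    ∃ G : Ultrafilter ℕ+, IsFree G ∧ W ∈ G := by
  have := cofinite_inf_principal_neBot_iff.2 hW
  refine ⟨Ultrafilter.of (cofinite ⊓ 𝓟 W), (Ultrafilter.of_le _).trans inf_le_left, ?_⟩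
  exact (Ultrafilter.of_le _).trans inf_le_right (mem_principal_self W)

theorem ultraLim_eq {F : Ultrafilter ℕ+} {x : ℕ+ → ℝ} {L : ℝ} (h : Tendsto x F (𝓝 L)) :
    ultraLim F x = L := h.limUnder_eq

/-- The set function `A ↦ G-lim_n Θ_{θ,n}(χ_A)`. -/
def thetaMeasure (θ : ℝ) (G : Ultrafilter ℕ+) (A : Set ℕ+) : ℝ :=
  ultraLim G fun n => Theta θ n (A.indicator 1)

theorem tendsto_thetaMeasure {θ : ℝ} (hθ : θ ∈ Set.Ioo (0 : ℝ) 1) (G : Ultrafilter ℕ+)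
    (A : Set ℕ+) :
    Tendsto (fun n => Theta θ n (A.indicator 1)) G (𝓝 (thetaMeasure θ G A)) :=
  tendsto_ultraLim G _ _ fun n => abs_Theta_indicator_le hθ n A

theorem isDensityMeasure_thetaMeasure {θ : ℝ} (hθ : θ ∈ Set.Ioo (0 : ℝ) 1) {G : Ultrafilter ℕ+}
    (hG : IsFree G) : IsDensityMeasure (thetaMeasure θ G) where
  mem_unitInterval A := by
    refine ⟨ge_of_tendsto' (tendsto_thetaMeasure hθ G A) fun n => Theta_indicator_nonneg hθ n A,
      le_of_tendsto_of_tendsto' (tendsto_thetaMeasure hθ G A)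
        ((tendsto_Theta hθ hasDensity_univ).mono_left hG.le_atTop) fun n => ?_⟩
    exact Theta_mono hθ n (indicator_one_le_univ A)
  additive A B hAB := by
    refine ultraLim_eq (((tendsto_thetaMeasure hθ G A).add (tendsto_thetaMeasure hθ G B)).congr
      fun n => ?_)
    rw [Set.indicator_union_of_disjoint hAB, Theta, Theta, Theta, ← add_div,
      ← Finset.sum_add_distrib]
  extends_density A d h := ultraLim_eq ((tendsto_Theta hθ h).mono_left hG.le_atTop)

theorem isClosed_densityMeasures : IsClosed densityMeasures := by
  have : densityMeasures = (⋂ A, {μ : Set ℕ+ → ℝ | μ A ∈ Set.Icc (0 : ℝ) 1}) ∩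
      (⋂ A, ⋂ B, ⋂ _ : Disjoint A B, {μ : Set ℕ+ → ℝ | μ (A ∪ B) = μ A + μ B}) ∩
      ⋂ A, ⋂ d, ⋂ _ : HasDensity A d, {μ : Set ℕ+ → ℝ | μ A = d} := by
    ext μ
    simp only [densityMeasures, Set.mem_inter_iff, Set.mem_iInter, Set.mem_ofPred_eq]
    exact ⟨fun h => ⟨⟨h.1, h.2⟩, h.3⟩, fun h => ⟨h.1.1, h.1.2, h.2⟩⟩
  rw [this]
  refine ((isClosed_iInter fun A => isClosed_Icc.preimage (continuous_apply A)).inter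
    (isClosed_iInter fun A => isClosed_iInter fun B => isClosed_iInter fun _ =>
      isClosed_eq ?_ ?_)).inter
    (isClosed_iInter fun A => isClosed_iInter fun d => isClosed_iInter fun _ =>
      isClosed_eq ?_ ?_) <;> fun_prop

theorem isCompact_densityMeasures : IsCompact densityMeasures :=
  (isCompact_univ_pi fun _ : Set ℕ+ => isCompact_Icc (a := (0 : ℝ)) (b := 1)).of_isClosed_subset
    isClosed_densityMeasures fun _ h A _ => h.mem_unitInterval A

theorem convex_densityMeasures : Convex ℝ densityMeasures := by
  intro μ hμ ν hν a b ha hb hab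
  refine ⟨fun A => ?_, fun A B h => ?_, fun A d h => ?_⟩
  · exact convex_Icc (0 : ℝ) 1 (hμ.mem_unitInterval A) (hν.mem_unitInterval A) ha hb hab
  · simp only [Pi.add_apply, Pi.smul_apply, smul_eq_mul, hμ.additive A B h, hν.additive A B h]
    ring
  · simp only [Pi.add_apply, Pi.smul_apply, smul_eq_mul, hμ.extends_density A d h,
      hν.extends_density A d h]
    rw [← add_mul, hab, one_mul]

theorem tendsto_ultraMeasure {θ : ℕ+ → ℝ} (hθ : ∀ k, θ k ∈ Set.Ioo (0 : ℝ) 1)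
    (F : Ultrafilter ℕ+) {G : Ultrafilter ℕ+} (hG : IsFree G) :
    Tendsto (fun k => thetaMeasure (θ k) G) F (𝓝 (ultraMeasure θ F G)) := by
  refine tendsto_pi_nhds.2 fun A => tendsto_ultraLim F _ 1 fun k => ?_
  have := (isDensityMeasure_thetaMeasure (hθ k) hG).mem_unitInterval A
  exact abs_le.2 ⟨by linarith [this.1], this.2⟩

theorem isDensityMeasure_ultraMeasure {θ : ℕ+ → ℝ} (hθ : ∀ k, θ k ∈ Set.Ioo (0 : ℝ) 1)
    (F : Ultrafilter ℕ+) {G : Ultrafilter ℕ+} (hG : IsFree G) :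
    IsDensityMeasure (ultraMeasure θ F G) :=
  isClosed_densityMeasures.mem_of_tendsto (tendsto_ultraMeasure hθ F hG)
    (Eventually.of_forall fun k => isDensityMeasure_thetaMeasure (hθ k) hG)

/-- If the averages of a simple sequence are not asymptotically at most `c`, its integral against
some `ultraMeasure` is at least `c`. -/
theorem exists_le_sum_ultraMeasure {θ : ℕ+ → ℝ} (hθ : ∀ k, θ k ∈ Set.Ioo (0 : ℝ) 1)
    (hlim : Tendsto θ atTop (𝓝 1)) {F : Ultrafilter ℕ+} (hF : IsFree F) {ι : Type*}
    (s : Finset ι) (a : ι → ℝ) (A : ι → Set ℕ+) {c : ℝ}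
    (hc : ¬ AveragesLE (fun n => ∑ i ∈ s, a i * (A i).indicator 1 n) c) :
    ∃ G : Ultrafilter ℕ+, IsFree G ∧ c ≤ ∑ i ∈ s, a i * ultraMeasure θ F G (A i) := by
  obtain ⟨δ, hδ, W, hW, hWle⟩ := exists_infinite_of_not_averagesLE
    (fun n => (abs_le.1 (abs_sum_indicator_le s a A n)).2) hc
  obtain ⟨G, hG, hWG⟩ := exists_isFree_mem hW
  refine ⟨G, hG, ?_⟩
  have hev : ∀ᶠ k in (F : Filter ℕ+), 1 - δ < θ k :=
    (hlim.mono_left hF.le_atTop).eventually_const_lt (by linarith)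
  refine ge_of_tendsto (tendsto_finsetSum s fun i _ =>
    (tendsto_pi_nhds.1 (tendsto_ultraMeasure hθ F hG) (A i)).const_mul (a i)) ?_
  filter_upwards [hev] with k hk
  -- The interval has `n - ⌊θ n⌋` terms rather than `n * (1 - θ)`, so the comparison is with `c *
  -- Theta` of the constant 1, which tends to `c`.
  have h1 : Tendsto (fun n => c * Theta (θ k) n (Set.univ.indicator 1)) G (𝓝 (c * 1)) :=
    ((tendsto_Theta (hθ k) hasDensity_univ).mono_left hG.le_atTop).const_mul c
  rw [mul_one] at h1
  refine le_of_tendsto_of_tendsto h1 (tendsto_finsetSum s fun i _ =>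
    (tendsto_thetaMeasure (hθ k) G (A i)).const_mul (a i)) ?_
  filter_upwards [hWG] with n hn
  have hn0 : (0 : ℝ) < n := by exact_mod_cast n.pos
  have hθ1 : 0 < 1 - θ k := sub_pos.2 (hθ k).2
  rw [← Theta_sum, Theta_eq (hθ k), Theta_eq (hθ k), partialSum_indicator_univ,
    partialSum_indicator_univ, ← mul_div_assoc]
  refine div_le_div_of_nonneg_right (hWle n hn _ ?_ ?_) (by positivity)
  · exact Nat.floor_le_of_le (by nlinarith [(hθ k).2])
  · have := Nat.lt_floor_add_one (θ k * (n : ℝ))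
    nlinarith

end DensityMeasures

end

/-! ### Separation argument and conclusion -/

theorem corollary6 (θ : ℕ+ → ℝ) (hθ : ∀ k, θ k ∈ Set.Ioo (0 : ℝ) 1)
    (hlim : Filter.Tendsto θ Filter.atTop (nhds 1))
    (F : Ultrafilter ℕ+) (hF : DensityMeasures.IsFree F)
    (S : Set (Set ℕ+ → ℝ))
    (hS : S = {μ | ∃ G : Ultrafilter ℕ+, DensityMeasures.IsFree G ∧
      μ = DensityMeasures.ultraMeasure θ F G}) :
    closedConvexHull ℝ S = DensityMeasures.densityMeasures ∧
      Set.extremePoints ℝ DensityMeasures.densityMeasures ⊆ closure S := by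
  have heq : closedConvexHull ℝ S = DensityMeasures.densityMeasures := by
    refine Set.Subset.antisymm (closedConvexHull_min ?_ DensityMeasures.convex_densityMeasures
      DensityMeasures.isClosed_densityMeasures) fun μ hμ => ?_
    · rw [hS]
      rintro _ ⟨G, hG, rfl⟩
      exact DensityMeasures.isDensityMeasure_ultraMeasure hθ F hG
    · by_contra hne
      obtain ⟨f, u, hfS, hfμ⟩ := geometric_hahn_banach_closed_point convex_closedConvexHull
        isClosed_closedConvexHull hne
      obtain ⟨I, a, hf⟩ := DensityMeasures.exists_finset_sum_eq f
      have hav : ¬ DensityMeasures.AveragesLE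
          (fun n => ∑ A ∈ I, a A * Set.indicator A 1 n) u := fun h => by
        have := DensityMeasures.IsDensityMeasure.sum_le_of_averagesLE hμ I a id h
        rw [hf μ] at hfμ
        exact absurd this (not_le.2 hfμ)
      obtain ⟨G, hG, hle⟩ :=
        DensityMeasures.exists_le_sum_ultraMeasure hθ hlim hF I a id hav
      have hmem : DensityMeasures.ultraMeasure θ F G ∈ S := by
        rw [hS]
        exact ⟨G, hG, rfl⟩
      have := hfS _ (subset_closedConvexHull hmem)
      rw [hf] at this
      exact absurd hle (not_le.2 this)
  refine ⟨heq, ?_⟩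
  have h := DensityMeasures.extremePoints_closedConvexHull_subset_closure (s := S)
    (by rw [heq]; exact DensityMeasures.isCompact_densityMeasures)
  rwa [heq] at h
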